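/- **Cut elimination for the calculi $LS_G$.** *Syntax.* Fix a set of propositional variables and an infinite set $V$ of label variables; a label is an element of $V$ or the constant $\epsilon\notin V$. Formulae are $A ::= p \mid \top \mid \bot \mid \top^* \mid A\wedge A \mid A\to A \mid A * A \mid A \mathbin{-\!*} A$. Relational atoms are $x=y$, $x\neq y$ and $(x,y\rhd z)$ for labels $x,y,z$. A sequent $\mathcal G;\Gamma\vdash\Delta$ consists of a finite set $\mathcal G$ of relational atoms and finite sets $\Gamma,\Delta$ of labelled formulae $w:A$; the symbol ";" denotes union. $E(\mathcal G)\vdash x=y$ means that $(x,y)$ lies in the least equivalence relation on labels containing all pairs $(a,b)$ with $(a=b)\in\mathcal G$. *Frame axioms.* A frame axiom has the form $$\forall x_1,\dots,x_m.\ \big(s_1=t_1 \,\&\cdots\&\, s_p=t_p \,\&\, S_1\,\&\cdots\&\, S_k \ \Rightarrow\ \exists y_1,\dots,y_n.\ (T_1\,\&\cdots\&\, T_l)\big)$$ with $m,n,p,k,l\ge 0$, where $s_i,t_i\in\{x_1,\dots,x_m,\epsilon\}$; each $S_i$ is an inequality or a ternary atom over $x_1,\dots,x_m,\epsilon$; $\epsilon$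 does not occur in a ternary $S_i$; every variable occurs at most once in $S_1,\dots,S_k$; and each $T_i$ is a relational atom over $x_1,\dots,x_m,y_1,\dots,y_n,\epsilon$. *Calculus.* Given a set $\mathcal{F}r$ of frame axioms, the corresponding instance of $LS_G$ has the following rules (premises / conclusion). - $id$: $\mathcal G;\Gamma;w:p\vdash w':p;\Delta$ if $E(\mathcal G)\vdash w=w'$ ($p$ a propositional variable). $\bot L$: $\mathcal G;\Gamma;w:\bot\vdash\Delta$. $\top R$: $\mathcal G;\Gamma\vdash w:\top;\Delta$. $\top^*R$: $\mathcal G;\Gamma\vdash w:\top^*;\Delta$ if $E(\mathcal G)\vdash w=\epsilon$. - $\top^*L$: $\mathcal G;w=\epsilon;\Gamma\vdash\Delta$ / $\mathcal G;\Gamma;w:\top^*\vdash\Delta$. - $\wedge L$: $\mathcal G;\Gamma;w:A;w:B\vdash\Delta$ / $\mathcal G;\Gamma;w:A\wedge B\vdash\Delta$. $\wedge R$: $\mathcal G;\Gamma\vdash w:A;\Delta$ and $\mathcal G;\Gamma\vdash w:B;\Delta$ / $\mathcal G;\Gamma\vdash w:A\wedge B;\Delta$. - ${\to}L$: $\mathcal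 G;\Gamma\vdash w:A;\Delta$ and $\mathcal G;\Gamma;w:B\vdash\Delta$ / $\mathcal G;\Gamma;w:A\to B\vdash\Delta$. ${\to}R$: $\mathcal G;\Gamma;w:A\vdash w:B;\Delta$ / $\mathcal G;\Gamma\vdash w:A\to B;\Delta$. - $*L$: $\mathcal G;(x,y\rhd z);\Gamma;x:A;y:B\vdash\Delta$ / $\mathcal G;\Gamma;z:A*B\vdash\Delta$, with $x,y$ distinct label variables not occurring in the conclusion. - ${-\!*}R$: $\mathcal G;(x,z\rhd y);\Gamma;x:A\vdash y:B;\Delta$ / $\mathcal G;\Gamma\vdash z:A\mathbin{-\!*}B;\Delta$, with $x,y$ distinct label variables not occurring in the conclusion. - $*R$: if $(x,y\rhd z)\in\mathcal G$ and $E(\mathcal G)\vdash z=z'$: $\mathcal G;\Gamma\vdash x:A;z':A*B;\Delta$ and $\mathcal G;\Gamma\vdash y:B;z':A*B;\Delta$ / $\mathcal G;\Gamma\vdash z':A*B;\Delta$. - ${-\!*}L$: if $(x,y\rhd z)\in\mathcal G$ and $E(\mathcal G)\vdash y=y'$: $\mathcal G;\Gamma;y':A\mathbin{-\!*}B\vdash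 x:A;\Delta$ and $\mathcal G;\Gamma;y':A\mathbin{-\!*}B;z:B\vdash\Delta$ / $\mathcal G;\Gamma;y':A\mathbin{-\!*}B\vdash\Delta$. - $NEq$: $\mathcal G;\Gamma\vdash\Delta$ if $(x\neq y)\in\mathcal G$ and $E(\mathcal G)\vdash x=y$. $EM$: $\mathcal G;x=y;\Gamma\vdash\Delta$ and $\mathcal G;x\neq y;\Gamma\vdash\Delta$ / $\mathcal G;\Gamma\vdash\Delta$. - For each frame axiom in $\mathcal{F}r$, the synthesised structural rule: for every substitution $\theta$ of labels for the $x_i$ and $\sigma$ of pairwise distinct label variables for the $y_j$, occurring neither in the conclusion nor among the labels $x_i\theta$, if $S_i\theta\in\mathcal G$ for all $i\le k$ and $E(\mathcal G)\vdash s_i\theta=t_i\theta$ for all $i\le p$: $\mathcal G;T_1\theta\sigma;\dots;T_l\theta\sigma;\Gamma\vdash\Delta$ / $\mathcal G;\Gamma\vdash\Delta$. *Theorem.* For every set $\mathcal{F}r$ of frame axioms, the cut rule $$\frac{\mathcal G;\Gamma\vdash w:A;\Delta\qquad \mathcal G';\Gamma';w:A\vdash\Delta'}{\mathcal G;\mathcal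 G';\Gamma;\Gamma'\vdash\Delta;\Delta'}$$ is admissible in the corresponding instance of $LS_G$: for all finite $\mathcal G,\mathcal G',\Gamma,\Gamma',\Delta,\Delta'$, every label $w$ and every formula $A$, if both premises are derivable without cut, then so is the conclusion. Consequently, every sequent derivable in that instance extended by the cut rule is derivable in it without cut. -/

import Mathlib

namespace LSG

/-- Formulae of propositional abstract separation logic over the propositional
variables `P`. -/
inductive Formula (P : Type*) : Type _
  | var (p : P)
  | top
  | bot
  /-- the multiplicative unit `⊤*` -/
  | emp
  | and (A B : Formula P)
  | imp (A B : Formula P)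
  /-- separating conjunction `A * B` -/
  | star (A B : Formula P)
  /-- separating implication `A -* B` -/
  | wand (A B : Formula P)

/-- Labels over a set `V` of label variables: a label variable, or the label constant `ε`. -/
inductive Label (V : Type*) : Type _
  | eps
  | var (v : V)

/-- Relational atoms over labels (or schematic labels) from `L`:
`a = b`, `a ≠ b` and `(a, b ▷ c)`. -/
inductive RelAtom (L : Type*) : Type _
  | eq (a b : L)
  | neq (a b : L)
  | rel (a b c : L)

/-- A labelled formula `w : A`. -/
structure LFormula (V P : Type*) where
  label : Label V
  formula : Formula P

noncomputable instance {L : Type*} : DecidableEq (RelAtom L) := Classical.decEq _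

noncomputable instance {V P : Type*} : DecidableEq (LFormula V P) := Classical.decEq _

/-- The label variables of a label, as a list. -/
def Label.vars {V : Type*} : Label V → List V
  | .eps => []
  | .var v => [v]

/-- The image of a label under a substitution of labels for its variables; `ε` is fixed. -/
def Label.subst {X V : Type*} (θ : X → Label V) : Label X → Label V
  | .eps => .eps
  | .var x => θ x

/-- The label variables of a relational atom, listed with repetition. -/
def RelAtom.vars {V : Type*} : RelAtom (Label V) → List V
  | .eq a b => a.vars ++ b.vars
  | .neq a b => a.vars ++ b.vars
  | .rel a b c => a.vars ++ b.vars ++ c.vars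

/-- The instance of a relational atom under a substitution of labels for its variables. -/
def RelAtom.subst {X V : Type*} (θ : X → Label V) : RelAtom (Label X) → RelAtom (Label V)
  | .eq a b => .eq (a.subst θ) (b.subst θ)
  | .neq a b => .neq (a.subst θ) (b.subst θ)
  | .rel a b c => .rel (a.subst θ) (b.subst θ) (c.subst θ)

/-- A frame axiom
`∀ x₁ … x_m, (s₁ = t₁ & … & s_p = t_p & S₁ & … & S_k ⇒ ∃ y₁ … y_n, (T₁ & … & T_l))`.
The list `eqs` holds the pairs `(sᵢ, tᵢ)`, `hyps` holds the `Sᵢ` and `concls` the `Tᵢ`.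
The schematic variables `x₁ … x_m` are `Fin m`, the variables `y₁ … y_n` are `Fin n`.
Every `Sᵢ` is an inequality or a ternary atom, `ε` does not occur in a ternary `Sᵢ`, and
every variable occurs at most once in `S₁, …, S_k`. -/
structure FrameAxiom where
  m : ℕ
  n : ℕ
  eqs : List (Label (Fin m) × Label (Fin m))
  hyps : List (RelAtom (Label (Fin m)))
  concls : List (RelAtom (Label (Fin m ⊕ Fin n)))
  hyps_not_eq : ∀ s t, RelAtom.eq s t ∉ hyps
  hyps_rel_ne_eps : ∀ a b c, RelAtom.rel a b c ∈ hyps →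
    a ≠ Label.eps ∧ b ≠ Label.eps ∧ c ≠ Label.eps
  hyps_linear : (hyps.flatMap RelAtom.vars).Nodup

/-- The judgment `E(G) ⊢ a = b`: the equation `a = b` follows from the equality atoms in `G` by
reflexivity, symmetry and transitivity. -/
def EqJudg {V : Type*} (G : Finset (RelAtom (Label V))) (a b : Label V) : Prop :=
  Relation.EqvGen (fun c d => RelAtom.eq c d ∈ G) a b

/-- The label variable `v` does not occur in the sequent `G ; Γ ⊢ Δ`. -/
def Fresh {V P : Type*} (v : V) (G : Finset (RelAtom (Label V)))
    (Γ Δ : Finset (LFormula V P)) : Prop :=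
  (∀ r ∈ G, v ∉ r.vars) ∧ (∀ F ∈ Γ, v ∉ F.label.vars) ∧ (∀ F ∈ Δ, v ∉ F.label.vars)

/-- `Derivable Ax c G Γ Δ`: the labelled sequent `G ; Γ ⊢ Δ` has a derivation in the instance of
the labelled calculus `LS_G` whose structural rules are `NEq`, `EM` and the rules synthesised from
the frame axioms in `Ax`. The cut rule may be used if `c = true`; if `c = false`, the calculus
has no cut rule. The components of a sequent are finite sets. -/
inductive Derivable {V P : Type*} (Ax : Set FrameAxiom) (c : Bool) :
    Finset (RelAtom (Label V)) → Finset (LFormula V P) → Finset (LFormula V P) → Prop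
  | id {G Γ Δ} (w w' : Label V) (p : P) (h : EqJudg G w w') :
      Derivable Ax c G (insert ⟨w, .var p⟩ Γ) (insert ⟨w', .var p⟩ Δ)
  | botL {G Γ Δ} (w : Label V) :
      Derivable Ax c G (insert ⟨w, .bot⟩ Γ) Δ
  | topR {G Γ Δ} (w : Label V) :
      Derivable Ax c G Γ (insert ⟨w, .top⟩ Δ)
  | empL {G Γ Δ} (w : Label V)
      (d : Derivable Ax c (insert (.eq w .eps) G) Γ Δ) :
      Derivable Ax c G (insert ⟨w, .emp⟩ Γ) Δ
  | empR {G Γ Δ} (w : Label V) (h : EqJudg G w .eps) :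
      Derivable Ax c G Γ (insert ⟨w, .emp⟩ Δ)
  | andL {G Γ Δ} (w : Label V) (A B : Formula P)
      (d : Derivable Ax c G (insert ⟨w, A⟩ (insert ⟨w, B⟩ Γ)) Δ) :
      Derivable Ax c G (insert ⟨w, .and A B⟩ Γ) Δ
  | andR {G Γ Δ} (w : Label V) (A B : Formula P)
      (d₁ : Derivable Ax c G Γ (insert ⟨w, A⟩ Δ))
      (d₂ : Derivable Ax c G Γ (insert ⟨w, B⟩ Δ)) :
      Derivable Ax c G Γ (insert ⟨w, .and A B⟩ Δ)
  | impL {G Γ Δ} (w : Label V) (A B : Formula P)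
      (d₁ : Derivable Ax c G Γ (insert ⟨w, A⟩ Δ))
      (d₂ : Derivable Ax c G (insert ⟨w, B⟩ Γ) Δ) :
      Derivable Ax c G (insert ⟨w, .imp A B⟩ Γ) Δ
  | impR {G Γ Δ} (w : Label V) (A B : Formula P)
      (d : Derivable Ax c G (insert ⟨w, A⟩ Γ) (insert ⟨w, B⟩ Δ)) :
      Derivable Ax c G Γ (insert ⟨w, .imp A B⟩ Δ)
  | starL {G Γ Δ} (z : Label V) (A B : Formula P) (x y : V) (hxy : x ≠ y)
      (hx : Fresh x G (insert ⟨z, .star A B⟩ Γ) Δ)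
      (hy : Fresh y G (insert ⟨z, .star A B⟩ Γ) Δ)
      (d : Derivable Ax c (insert (.rel (.var x) (.var y) z) G)
        (insert ⟨.var x, A⟩ (insert ⟨.var y, B⟩ Γ)) Δ) :
      Derivable Ax c G (insert ⟨z, .star A B⟩ Γ) Δ
  | starR {G Γ Δ} (x y z z' : Label V) (A B : Formula P)
      (hr : RelAtom.rel x y z ∈ G) (h : EqJudg G z z')
      (d₁ : Derivable Ax c G Γ (insert ⟨x, A⟩ (insert ⟨z', .star A B⟩ Δ)))
      (d₂ : Derivable Ax c G Γ (insert ⟨y, B⟩ (insert ⟨z', .star A B⟩ Δ))) :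
      Derivable Ax c G Γ (insert ⟨z', .star A B⟩ Δ)
  | wandL {G Γ Δ} (x y y' z : Label V) (A B : Formula P)
      (hr : RelAtom.rel x y z ∈ G) (h : EqJudg G y y')
      (d₁ : Derivable Ax c G (insert ⟨y', .wand A B⟩ Γ) (insert ⟨x, A⟩ Δ))
      (d₂ : Derivable Ax c G (insert ⟨z, B⟩ (insert ⟨y', .wand A B⟩ Γ)) Δ) :
      Derivable Ax c G (insert ⟨y', .wand A B⟩ Γ) Δ
  | wandR {G Γ Δ} (z : Label V) (A B : Formula P) (x y : V) (hxy : x ≠ y)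
      (hx : Fresh x G Γ (insert ⟨z, .wand A B⟩ Δ))
      (hy : Fresh y G Γ (insert ⟨z, .wand A B⟩ Δ))
      (d : Derivable Ax c (insert (.rel (.var x) z (.var y)) G)
        (insert ⟨.var x, A⟩ Γ) (insert ⟨.var y, B⟩ Δ)) :
      Derivable Ax c G Γ (insert ⟨z, .wand A B⟩ Δ)
  | nEq {G Γ Δ} (x y : Label V) (hr : RelAtom.neq x y ∈ G) (h : EqJudg G x y) :
      Derivable Ax c G Γ Δ
  | em {G Γ Δ} (x y : Label V)
      (d₁ : Derivable Ax c (insert (.eq x y) G) Γ Δ)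
      (d₂ : Derivable Ax c (insert (.neq x y) G) Γ Δ) :
      Derivable Ax c G Γ Δ
  /-- The structural rule synthesised from the frame axiom `F`. The substitution `θ` instantiates
  the variables `xᵢ` by labels; `σ` instantiates the variables `yⱼ` by pairwise distinct label
  variables that occur neither in the conclusion nor in the labels `θ xᵢ`. -/
  | frame {G Γ Δ} (F : FrameAxiom) (hF : F ∈ Ax) (θ : Fin F.m → Label V) (σ : Fin F.n → V)
      (hσ : Function.Injective σ)
      (hσ_fresh : ∀ j, Fresh (σ j) G Γ Δ)
      (hσ_ne : ∀ j i, θ i ≠ Label.var (σ j))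
      (heqs : ∀ e ∈ F.eqs, EqJudg G (e.1.subst θ) (e.2.subst θ))
      (hhyps : ∀ S ∈ F.hyps, S.subst θ ∈ G)
      (d : Derivable Ax c
        (G ∪ (F.concls.map (RelAtom.subst (Sum.elim θ (fun j => Label.var (σ j))))).toFinset)
        Γ Δ) :
      Derivable Ax c G Γ Δ
  | cut {G G' Γ Γ' Δ Δ'} (hc : c = true) (w : Label V) (A : Formula P)
      (d₁ : Derivable Ax c G Γ (insert ⟨w, A⟩ Δ))
      (d₂ : Derivable Ax c G' (insert ⟨w, A⟩ Γ') Δ') :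
      Derivable Ax c (G ∪ G') (Γ ∪ Γ') (Δ ∪ Δ')

end LSG

/-!
Cut elimination is obtained semantically. The worlds of a Kripke model are the sequents themselves,
ordered by inclusion, and the absurd worlds are the cut-free derivable ones. Formulae are
interpreted by predicates stable under the double negation relative to this absurdity. The left and
right rules say exactly that a sequent forces each formula on its left and refutes each formula on
its right; `EM`, `NEq` and the synthesised rules say that every frame axiom is true in the model, up
to double negation. All rules, cut included, are sound for this model, and soundness evaluated at
the world `G; Γ ⊢ Δ` itself yields a cut-free derivation of `G; Γ ⊢ Δ`.
-/

namespace LSG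

/-! ### Double negation over a preorder -/

section Preorder

variable {α : Type*} [Preorder α] {B X Y : α → Prop} {a : α}

/-- Kripke implication between predicates on the worlds `α`. For a fixed target `B` it is the
negation relative to `B`. -/
def KripkeImp (X Y : α → Prop) (a : α) : Prop :=
  ∀ b, a ≤ b → X b → Y b

/-- The double negation of `X` relative to the absurdity `B`. -/
def Closure (B X : α → Prop) : α → Prop :=
  KripkeImp (KripkeImp X B) B

/-- The predicate `X` contains its double negation relative to `B`. -/
def Stable (B X : α → Prop) : Prop :=
  ∀ ⦃a⦄, Closure B X a → X a

theorem monotone_kripkeImp : Monotone (KripkeImp X Y) :=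
  fun _ _ hab h c hbc => h c (hab.trans hbc)

theorem monotone_closure : Monotone (Closure B X) :=
  monotone_kripkeImp

theorem Closure.of_monotone (hX : Monotone X) (h : X a) : Closure B X a :=
  fun b hab hb => hb b le_rfl (hX hab h)

theorem Closure.bind (h : Closure B X a) (hXY : KripkeImp X (Closure B Y) a) : Closure B Y a :=
  fun b hab hb => h b hab fun c hbc hX =>
    hXY c (hab.trans hbc) hX c le_rfl fun d hcd => hb d (hbc.trans hcd)

theorem Closure.map (h : Closure B X a) (hXY : KripkeImp X Y a) : Closure B Y a :=
  fun b hab hb => h b hab fun c hbc hX => hb c hbc (hXY c (hab.trans hbc) hX)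

theorem closure_forall_mem {ι : Type*} {X : ι → α → Prop} (hX : ∀ i, Monotone (X i))
    {l : List ι} (h : ∀ i ∈ l, Closure B (X i) a) : Closure B (fun b => ∀ i ∈ l, X i b) a := by
  induction l with
  | nil => exact fun b _ hb => hb b le_rfl (by simp)
  | cons i l ih =>
    rw [List.forall_mem_cons] at h
    simp only [List.forall_mem_cons]
    exact h.1.bind fun b hab hb => (monotone_closure hab (ih h.2)).map fun c hbc hc =>
      ⟨hX i hbc hb, hc⟩

theorem stable_self : Stable B B :=
  fun _ h => h _ le_rfl fun _ _ => id

theorem stable_closure : Stable B (Closure B X) :=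
  fun _ h => h.bind fun _ _ => id

theorem Stable.and (hX : Stable B X) (hY : Stable B Y) : Stable B fun a => X a ∧ Y a :=
  fun _ h => ⟨hX (h.map fun _ _ => And.left), hY (h.map fun _ _ => And.right)⟩

theorem Stable.forall {ι : Type*} {X : ι → α → Prop} (hX : ∀ i, Stable B (X i)) :
    Stable B fun a => ∀ i, X i a :=
  fun _ h i => hX i (h.map fun _ _ hb => hb i)

theorem Stable.kripkeImp (hX : Monotone X) (hY : Stable B Y) : Stable B (KripkeImp X Y) :=
  fun _ h _ hab hXb => hY <|
    (monotone_closure hab h).map fun c hbc hXY => hXY c le_rfl (hX hbc hXb)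

end Preorder

/-! ### Substitution -/

section Substitution

variable {V X Y : Type*}

theorem Label.subst_subst (θ : X → Label Y) (ρ : Y → Label V) (l : Label X) :
    (l.subst θ).subst ρ = l.subst fun i => (θ i).subst ρ := by
  cases l <;> rfl

theorem RelAtom.subst_subst (θ : X → Label Y) (ρ : Y → Label V) (r : RelAtom (Label X)) :
    (r.subst θ).subst ρ = r.subst fun i => (θ i).subst ρ := by
  cases r <;> simp only [RelAtom.subst, Label.subst_subst]

theorem Label.subst_var (l : Label V) : l.subst Label.var = l := by
  cases l <;> rfl

theorem RelAtom.subst_var (r : RelAtom (Label V)) : r.subst Label.var = r := by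
  cases r <;> simp only [RelAtom.subst, Label.subst_var]

theorem Label.subst_congr {θ θ' : X → Label V} {l : Label X} (h : ∀ i ∈ l.vars, θ i = θ' i) :
    l.subst θ = l.subst θ' := by
  cases l with
  | eps => rfl
  | var i => exact h i (List.mem_singleton_self i)

theorem RelAtom.subst_congr {θ θ' : X → Label V} {r : RelAtom (Label X)}
    (h : ∀ i ∈ r.vars, θ i = θ' i) : r.subst θ = r.subst θ' := by
  cases r <;> simp only [RelAtom.vars, List.forall_mem_append] at h
  case eq | neq =>
    simp only [RelAtom.subst, Label.subst_congr h.1, Label.subst_congr h.2]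
  case rel =>
    simp only [RelAtom.subst, Label.subst_congr h.1.1, Label.subst_congr h.1.2,
      Label.subst_congr h.2]

variable {ι : Type*} {σ : ι → X} {θ : X → Label V} (τ : ι → Label V)

theorem Label.subst_extend {l : Label X} (h : ∀ j, σ j ∉ l.vars) :
    l.subst (Function.extend σ τ θ) = l.subst θ :=
  Label.subst_congr fun i hi => Function.extend_apply' _ _ i fun ⟨j, hj⟩ => h j (hj ▸ hi)

theorem RelAtom.subst_extend {r : RelAtom (Label X)} (h : ∀ j, σ j ∉ r.vars) :
    r.subst (Function.extend σ τ θ) = r.subst θ :=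
  RelAtom.subst_congr fun i hi => Function.extend_apply' _ _ i fun ⟨j, hj⟩ => h j (hj ▸ hi)

end Substitution

/-! ### Relational atoms up to equality of labels -/

section Holds

variable {V X : Type*} {G G' : Finset (RelAtom (Label V))} {a b c a' b' c' : Label V}

theorem EqJudg.refl (a : Label V) : EqJudg G a a :=
  Relation.EqvGen.refl a

theorem EqJudg.symm (h : EqJudg G a b) : EqJudg G b a :=
  Relation.EqvGen.symm _ _ h

theorem EqJudg.trans (h : EqJudg G a b) (h' : EqJudg G b c) : EqJudg G a c :=
  Relation.EqvGen.trans _ _ _ h h'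

theorem EqJudg.of_mem (h : RelAtom.eq a b ∈ G) : EqJudg G a b :=
  Relation.EqvGen.rel _ _ h

theorem EqJudg.mono (hG : G ⊆ G') (h : EqJudg G a b) : EqJudg G' a b :=
  Relation.EqvGen.mono (fun _ _ hab => hG hab) _ _ h

/-- The relational atom follows from `G` by replacing labels by labels that `G` proves equal. -/
def Holds (G : Finset (RelAtom (Label V))) : RelAtom (Label V) → Prop
  | .eq a b => EqJudg G a b
  | .neq a b => ∃ a' b', RelAtom.neq a' b' ∈ G ∧ EqJudg G a a' ∧ EqJudg G b b'
  | .rel a b c => ∃ a' b' c', RelAtom.rel a' b' c' ∈ G ∧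
      EqJudg G a a' ∧ EqJudg G b b' ∧ EqJudg G c c'

theorem Holds.of_mem {r : RelAtom (Label V)} (h : r ∈ G) : Holds G r := by
  cases r with
  | eq a b => exact EqJudg.of_mem h
  | neq a b => exact ⟨a, b, h, .refl a, .refl b⟩
  | rel a b c => exact ⟨a, b, c, h, .refl a, .refl b, .refl c⟩

theorem Holds.mono (hG : G ⊆ G') {r : RelAtom (Label V)} (h : Holds G r) : Holds G' r := by
  cases r with
  | eq a b => exact EqJudg.mono hG h
  | neq a b =>
    obtain ⟨a', b', hr, ha, hb⟩ := h
    exact ⟨a', b', hG hr, ha.mono hG, hb.mono hG⟩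
  | rel a b c =>
    obtain ⟨a', b', c', hr, ha, hb, hc⟩ := h
    exact ⟨a', b', c', hG hr, ha.mono hG, hb.mono hG, hc.mono hG⟩

theorem Holds.rel_congr (ha : EqJudg G a a') (hb : EqJudg G b b') (hc : EqJudg G c c')
    (h : Holds G (.rel a' b' c')) : Holds G (.rel a b c) := by
  obtain ⟨a'', b'', c'', hr, ha', hb', hc'⟩ := h
  exact ⟨a'', b'', c'', hr, ha.trans ha', hb.trans hb', hc.trans hc'⟩

variable {θ θ' : X → Label V}

theorem EqJudg.subst_congr (h : ∀ i, EqJudg G (θ i) (θ' i)) (l : Label X) :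
    EqJudg G (l.subst θ) (l.subst θ') := by
  cases l with
  | eps => exact .refl _
  | var i => exact h i

theorem Holds.subst_congr (h : ∀ i, EqJudg G (θ i) (θ' i)) {r : RelAtom (Label X)}
    (hr : Holds G (r.subst θ')) : Holds G (r.subst θ) := by
  have hl := EqJudg.subst_congr h
  cases r with
  | eq a b => exact (hl a).trans (EqJudg.trans hr (hl b).symm)
  | neq a b =>
    obtain ⟨a', b', hr, ha, hb⟩ := hr
    exact ⟨a', b', hr, (hl a).trans ha, (hl b).trans hb⟩
  | rel a b c => exact Holds.rel_congr (hl a) (hl b) (hl c) hr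

theorem EqJudg.subst {G : Finset (RelAtom (Label X))} (hG : ∀ r ∈ G, Holds G' (r.subst θ))
    {a b : Label X} (h : EqJudg G a b) : EqJudg G' (a.subst θ) (b.subst θ) := by
  induction h with
  | rel a b h => exact hG _ h
  | refl a => exact .refl _
  | symm a b _ ih => exact ih.symm
  | trans a b c _ _ ih ih' => exact ih.trans ih'

theorem exists_subst_mem_of_holds_rel {x y z : X} (hxyz : [x, y, z].Nodup)
    (h : Holds G ((RelAtom.rel (.var x) (.var y) (.var z)).subst θ)) :
    ∃ θ', (∀ i, EqJudg G (θ i) (θ' i)) ∧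
      (RelAtom.rel (.var x) (.var y) (.var z)).subst θ' ∈ G := by
  classical
  obtain ⟨a, b, c, habc, ha, hb, hc⟩ := h
  obtain ⟨⟨hxy, hxz⟩, hyz⟩ : (x ≠ y ∧ x ≠ z) ∧ y ≠ z := by simpa using hxyz
  refine ⟨Function.update (Function.update (Function.update θ x a) y b) z c, fun i => ?_, ?_⟩
  · simp only [Function.update_apply]
    split_ifs with hiz hiy hix
    exacts [hiz ▸ hc, hiy ▸ hb, hix ▸ ha, .refl _]
  · simpa [RelAtom.subst, Label.subst, hxy, hxz, hyz] using habc

/-- This is where the linearity of frame axioms is needed: atoms sharing no variable can be matched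
independently of each other. -/
theorem exists_subst_forall_mem {hs : List (RelAtom (Label X))}
    (hlin : (hs.flatMap RelAtom.vars).Nodup)
    (h : ∀ r ∈ hs, ∃ θ', (∀ i, EqJudg G (θ i) (θ' i)) ∧ r.subst θ' ∈ G) :
    ∃ θ', (∀ i, EqJudg G (θ i) (θ' i)) ∧ ∀ r ∈ hs, r.subst θ' ∈ G := by
  classical
  induction hs with
  | nil => exact ⟨θ, fun i => .refl _, by simp⟩
  | cons r hs ih =>
    rw [List.flatMap_cons, List.nodup_append'] at hlin
    rw [List.forall_mem_cons] at h
    obtain ⟨-, hlin, hdisj⟩ := hlin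
    obtain ⟨⟨θ₁, hθ₁, hr⟩, h⟩ := h
    obtain ⟨θ₂, hθ₂, hhs⟩ := ih hlin h
    refine ⟨fun i => if i ∈ r.vars then θ₁ i else θ₂ i, fun i => ?_,
      List.forall_mem_cons.2 ⟨?_, fun s hs' => ?_⟩⟩
    · dsimp only
      split_ifs
      exacts [hθ₁ i, hθ₂ i]
    · rwa [RelAtom.subst_congr fun i hi => if_pos hi]
    · rw [RelAtom.subst_congr fun i hi => if_neg fun hir =>
        hdisj hir (List.mem_flatMap.2 ⟨s, hs', hi⟩)]
      exact hhs s hs'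

end Holds

/-! ### Sequents as worlds -/

/-- The sequent `rels; left ⊢ right`, seen as a world of the canonical model. -/
structure Sequent (V P : Type*) where
  rels : Finset (RelAtom (Label V))
  left : Finset (LFormula V P)
  right : Finset (LFormula V P)

namespace Sequent

variable {V P : Type*}

instance : Preorder (Sequent V P) where
  le S T := S.rels ⊆ T.rels ∧ S.left ⊆ T.left ∧ S.right ⊆ T.right
  le_refl _ := ⟨subset_rfl, subset_rfl, subset_rfl⟩
  le_trans _ _ _ h h' := ⟨h.1.trans h'.1, h.2.1.trans h'.2.1, h.2.2.trans h'.2.2⟩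

/-- The extension of a sequent by a relational atom. -/
noncomputable def addRel (S : Sequent V P) (r : RelAtom (Label V)) : Sequent V P :=
  { S with rels := insert r S.rels }

/-- The extension of a sequent by a formula on the left. -/
noncomputable def addLeft (S : Sequent V P) (F : LFormula V P) : Sequent V P :=
  { S with left := insert F S.left }

/-- The extension of a sequent by a formula on the right. -/
noncomputable def addRight (S : Sequent V P) (F : LFormula V P) : Sequent V P :=
  { S with right := insert F S.right }

/-- The labelled formula `w : A` occurs on the left, up to equality of labels. -/
def InLeft (w : Label V) (A : Formula P) (S : Sequent V P) : Prop :=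
  ∃ w', ⟨w', A⟩ ∈ S.left ∧ EqJudg S.rels w w'

/-- The labelled formula `w : A` occurs on the right, up to equality of labels. -/
def InRight (w : Label V) (A : Formula P) (S : Sequent V P) : Prop :=
  ∃ w', ⟨w', A⟩ ∈ S.right ∧ EqJudg S.rels w w'

/-- Cut-free derivability, the absurdity of the canonical model. -/
def Provable (Ax : Set FrameAxiom) (S : Sequent V P) : Prop :=
  Derivable Ax false S.rels S.left S.right

variable {Ax : Set FrameAxiom} {S : Sequent V P} {w w' : Label V} {A : Formula P}

theorem le_addRel (r : RelAtom (Label V)) : S ≤ S.addRel r :=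
  ⟨Finset.subset_insert _ _, subset_rfl, subset_rfl⟩

theorem le_addLeft (F : LFormula V P) : S ≤ S.addLeft F :=
  ⟨subset_rfl, Finset.subset_insert _ _, subset_rfl⟩

theorem le_addRight (F : LFormula V P) : S ≤ S.addRight F :=
  ⟨subset_rfl, subset_rfl, Finset.subset_insert _ _⟩

theorem holds_addRel (r : RelAtom (Label V)) : Holds (S.addRel r).rels r :=
  .of_mem (Finset.mem_insert_self _ _)

theorem inLeft_addLeft (h : EqJudg S.rels w w') : InLeft w A (S.addLeft ⟨w', A⟩) :=
  ⟨w', Finset.mem_insert_self _ _, h⟩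

theorem inRight_addRight (h : EqJudg S.rels w w') : InRight w A (S.addRight ⟨w', A⟩) :=
  ⟨w', Finset.mem_insert_self _ _, h⟩

theorem monotone_mem_rels (r : RelAtom (Label V)) : Monotone fun S : Sequent V P => r ∈ S.rels :=
  fun _ _ h hr => h.1 hr

theorem monotone_inLeft : Monotone (InLeft w A : Sequent V P → Prop) :=
  fun _ _ h ⟨w', hw', he⟩ => ⟨w', h.2.1 hw', he.mono h.1⟩

theorem monotone_inRight : Monotone (InRight w A : Sequent V P → Prop) :=
  fun _ _ h ⟨w', hw', he⟩ => ⟨w', h.2.2 hw', he.mono h.1⟩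

theorem InLeft.provable (h : InLeft w A S)
    (hS : ∀ w', EqJudg S.rels w w' → (S.addLeft ⟨w', A⟩).Provable Ax) : S.Provable Ax := by
  obtain ⟨w', hw', he⟩ := h
  simpa only [Provable, addLeft, Finset.insert_eq_of_mem hw'] using hS w' he

theorem InRight.provable (h : InRight w A S)
    (hS : ∀ w', EqJudg S.rels w w' → (S.addRight ⟨w', A⟩).Provable Ax) : S.Provable Ax := by
  obtain ⟨w', hw', he⟩ := h
  simpa only [Provable, addRight, Finset.insert_eq_of_mem hw'] using hS w' he

theorem finite_setOf_not_fresh (S : Sequent V P) :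
    {v | ¬ Fresh v S.rels S.left S.right}.Finite := by
  have hvars : {v | ¬ Fresh v S.rels S.left S.right} =
      (⋃ r ∈ S.rels, {v | v ∈ r.vars}) ∪ (⋃ F ∈ S.left, {v | v ∈ F.label.vars}) ∪
        ⋃ F ∈ S.right, {v | v ∈ F.label.vars} := by
    ext v
    simp only [Fresh, Set.mem_ofPred_eq, Set.mem_union, Set.mem_iUnion, exists_prop]
    grind
  rw [hvars]
  exact ((S.rels.finite_toSet.biUnion fun r _ => r.vars.finite_toSet).union
    (S.left.finite_toSet.biUnion fun F _ => F.label.vars.finite_toSet)).union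
    (S.right.finite_toSet.biUnion fun F _ => F.label.vars.finite_toSet)

theorem exists_fresh [Infinite V] (S : Sequent V P) (n : ℕ) {N : Set V} (hN : N.Finite) :
    ∃ σ : Fin n → V, Function.Injective σ ∧
      ∀ j, Fresh (σ j) S.rels S.left S.right ∧ σ j ∉ N := by
  let e := (S.finite_setOf_not_fresh.union hN).infinite_compl.natEmbedding
  refine ⟨fun j => e j, Subtype.val_injective.comp (e.injective.comp Fin.val_injective),
    fun j => ?_⟩
  simpa [not_or] using (e j).2

end Sequent

open Sequent

/-! ### The relational atoms of the canonical model -/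

section Relational

variable {V P : Type*} {Ax : Set FrameAxiom} {S : Sequent V P}

theorem provable_of_holds_neq_of_eqJudg {a b : Label V} (hneq : Holds S.rels (.neq a b))
    (heq : EqJudg S.rels a b) : S.Provable Ax := by
  obtain ⟨a', b', hr, ha, hb⟩ := hneq
  exact .nEq a' b' hr (ha.symm.trans (heq.trans hb))

theorem closure_eqJudg_or_mem_neq (a b : Label V) :
    Closure (Provable Ax) (fun T => EqJudg T.rels a b ∨ .neq a b ∈ T.rels) S :=
  fun _ _ h => .em a b (h _ (le_addRel (.eq a b)) (.inl (holds_addRel (.eq a b))))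
    (h _ (le_addRel (.neq a b)) (.inr (Finset.mem_insert_self _ _)))

theorem closure_mem_neq {a b : Label V} (h : Holds S.rels (.neq a b)) :
    Closure (Provable Ax) (fun T => .neq a b ∈ T.rels) S :=
  (closure_eqJudg_or_mem_neq a b).bind fun _ hST hT => hT.elim
    (fun heq _ hTU _ =>
      provable_of_holds_neq_of_eqJudg (h.mono (hST.trans hTU).1) (heq.mono hTU.1))
    (Closure.of_monotone (monotone_mem_rels _))

namespace FrameAxiom

variable {F : FrameAxiom} {θ : Fin F.m → Label V}

theorem closure_exists_match (hhyps : ∀ r ∈ F.hyps, Holds S.rels (r.subst θ)) :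
    Closure (Provable Ax) (fun T => ∃ θ' : Fin F.m → Label V,
      (∀ i, EqJudg T.rels (θ i) (θ' i)) ∧ ∀ r ∈ F.hyps, r.subst θ' ∈ T.rels) S := by
  have hmatch : ∀ r ∈ F.hyps, Closure (Provable Ax) (fun T => ∃ θ' : Fin F.m → Label V,
      (∀ i, EqJudg T.rels (θ i) (θ' i)) ∧ r.subst θ' ∈ T.rels) S := by
    intro r hr
    cases r with
    | eq a b => exact absurd hr (F.hyps_not_eq a b)
    | neq a b => exact (closure_mem_neq (hhyps _ hr)).map fun T _ hT => ⟨θ, fun i => .refl _, hT⟩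
    | rel a b c =>
      have hnodup : (RelAtom.rel a b c).vars.Nodup := (List.nodup_flatMap.1 F.hyps_linear).1 _ hr
      obtain ⟨ha, hb, hc⟩ := F.hyps_rel_ne_eps a b c hr
      cases a with | eps => exact absurd rfl ha | var a =>
      cases b with | eps => exact absurd rfl hb | var b =>
      cases c with | eps => exact absurd rfl hc | var c =>
      exact fun T hST hT => hT T le_rfl
        (exists_subst_mem_of_holds_rel hnodup ((hhyps _ hr).mono hST.1))
  refine (closure_forall_mem (fun r T U hTU ⟨θ', hθ', hr⟩ => ?_) hmatch).map fun T _ hT =>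
    exists_subst_forall_mem F.hyps_linear hT
  exact ⟨θ', fun i => (hθ' i).mono hTU.1, hTU.1 hr⟩

theorem closure_exists_concls_of_mem [Infinite V] (hF : F ∈ Ax)
    (heqs : ∀ e ∈ F.eqs, EqJudg S.rels (e.1.subst θ) (e.2.subst θ))
    (hhyps : ∀ r ∈ F.hyps, r.subst θ ∈ S.rels) :
    Closure (Provable Ax) (fun T => ∃ τ : Fin F.n → Label V,
      ∀ r ∈ F.concls, Holds T.rels (r.subst (Sum.elim θ τ))) S := by
  intro T hST hT
  obtain ⟨σ, hσ, hfresh⟩ := T.exists_fresh F.n (N := ⋃ i, {v | v ∈ (θ i).vars})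
    (Set.finite_iUnion fun i => (θ i).vars.finite_toSet)
  have hne : ∀ j i, θ i ≠ .var (σ j) := fun j i h =>
    (hfresh j).2 (Set.mem_iUnion.2 ⟨i, h ▸ List.mem_singleton_self _⟩)
  refine .frame F hF θ σ hσ (fun j => (hfresh j).1) hne (fun e he => (heqs e he).mono hST.1)
    (fun r hr => hST.1 (hhyps r hr)) (hT ⟨_, T.left, T.right⟩
      ⟨Finset.subset_union_left, subset_rfl, subset_rfl⟩ ⟨fun j => .var (σ j), fun r hr => ?_⟩)
  exact .of_mem (Finset.mem_union_right _ (List.mem_toFinset.2 (List.mem_map_of_mem hr)))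

theorem closure_exists_concls [Infinite V] (hF : F ∈ Ax)
    (heqs : ∀ e ∈ F.eqs, EqJudg S.rels (e.1.subst θ) (e.2.subst θ))
    (hhyps : ∀ r ∈ F.hyps, Holds S.rels (r.subst θ)) :
    Closure (Provable Ax) (fun T => ∃ τ : Fin F.n → Label V,
      ∀ r ∈ F.concls, Holds T.rels (r.subst (Sum.elim θ τ))) S := by
  refine (closure_exists_match hhyps).bind fun T hST ⟨θ', hθ', hmem⟩ => ?_
  have hl := EqJudg.subst_congr hθ'
  refine (closure_exists_concls_of_mem hF (fun e he =>
    (hl e.1).symm.trans (((heqs e he).mono hST.1).trans (hl e.2))) hmem).map ?_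
  rintro U hTU ⟨τ, hτ⟩
  refine ⟨τ, fun r hr => Holds.subst_congr ?_ (hτ r hr)⟩
  rintro (i | j)
  exacts [(hθ' i).mono hTU.1, .refl _]

end FrameAxiom

end Relational

/-! ### Forcing -/

section Forcing

variable {V P : Type*} {Ax : Set FrameAxiom}

/-- The interpretation of labelled formulae in the canonical model. -/
def Forces (Ax : Set FrameAxiom) : Formula P → Label V → Sequent V P → Prop
  | .var p, w => KripkeImp (InRight w (.var p)) (Provable Ax)
  | .top, _ => fun _ => True
  | .bot, _ => KripkeImp (fun _ => True) (Provable Ax)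
  | .emp, w => Closure (Provable Ax) fun S => EqJudg S.rels w .eps
  | .and A B, w => fun S => Forces Ax A w S ∧ Forces Ax B w S
  | .imp A B, w => KripkeImp (Forces Ax A w) (Forces Ax B w)
  | .star A B, z => Closure (Provable Ax) fun S =>
      ∃ x y, Holds S.rels (.rel x y z) ∧ Forces Ax A x S ∧ Forces Ax B y S
  | .wand A B, z => fun S => ∀ x y,
      KripkeImp (fun T => Holds T.rels (.rel x z y) ∧ Forces Ax A x T) (Forces Ax B y) S

/-- The labelled formula `w : A` is false in the canonical model. -/
def Refutes (Ax : Set FrameAxiom) (A : Formula P) (w : Label V) : Sequent V P → Prop :=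
  KripkeImp (Forces Ax A w) (Provable Ax)

theorem monotone_forces (A : Formula P) (w : Label V) : Monotone (Forces Ax A w) := by
  induction A generalizing w with
  | var | bot | emp | imp | star => exact monotone_kripkeImp
  | top => exact monotone_const
  | and A B ihA ihB => exact fun _ _ h hS => ⟨ihA w h hS.1, ihB w h hS.2⟩
  | wand A B => exact fun _ _ h hS x y => monotone_kripkeImp h (hS x y)

theorem stable_forces (A : Formula P) (w : Label V) : Stable (Provable Ax) (Forces Ax A w) := by
  induction A generalizing w with
  | var p => exact stable_self.kripkeImp monotone_inRight
  | top => exact fun _ _ => trivial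
  | bot => exact stable_self.kripkeImp monotone_const
  | emp | star => exact stable_closure
  | and A B ihA ihB => exact (ihA w).and (ihB w)
  | imp A B _ ihB => exact (ihB w).kripkeImp (monotone_forces A w)
  | wand A B _ ihB =>
    exact .forall fun x => .forall fun y => (ihB y).kripkeImp fun _ _ h hS =>
      ⟨hS.1.mono h.1, monotone_forces A x h hS.2⟩

theorem Forces.mono {A : Formula P} {w : Label V} {S T : Sequent V P} (hS : Forces Ax A w S)
    (h : S ≤ T) : Forces Ax A w T :=
  monotone_forces A w h hS

theorem Forces.var_congr {p : P} {w w' : Label V} {S : Sequent V P} (h : EqJudg S.rels w w')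
    (hS : Forces Ax (.var p) w S) : Forces Ax (.var p) w' S :=
  fun T hT ⟨u, hu, hwu⟩ => hS T hT ⟨u, hu, (h.mono hT.1).trans hwu⟩

end Forcing

/-! ### Sequents force their left and refute their right -/

/-- Every world forces `A` at the labels where it has `A` on the left, and refutes `A` at the labels
where it has `A` on the right. -/
structure Adequate (V : Type*) {P : Type*} (Ax : Set FrameAxiom) (A : Formula P) : Prop where
  left {w : Label V} {S : Sequent V P} (h : InLeft w A S) : Forces Ax A w S
  right {w : Label V} {S : Sequent V P} (h : InRight w A S) : Refutes Ax A w S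

namespace Adequate

variable {V P : Type*} {Ax : Set FrameAxiom} {A B : Formula P}

theorem var (p : P) : Adequate V Ax (.var p) where
  left h _ hST hR := (monotone_inLeft hST h).provable fun w₁ h₁ =>
    (monotone_inRight (le_addLeft _) hR).provable fun w₂ h₂ => .id w₁ w₂ p (h₁.symm.trans h₂)
  right h T hST hT := hT T le_rfl (monotone_inRight hST h)

theorem top : Adequate V Ax (.top : Formula P) where
  left _ := trivial
  right h _ hST _ := (monotone_inRight hST h).provable fun w' _ => .topR w'

theorem bot : Adequate V Ax (.bot : Formula P) where
  left h _ hST _ := (monotone_inLeft hST h).provable fun w' _ => .botL w'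
  right _ T _ hT := hT T le_rfl trivial

theorem emp : Adequate V Ax (.emp : Formula P) where
  left h T hST hT := (monotone_inLeft hST h).provable fun w' hw =>
    have hle := le_addRel (S := T) (.eq w' .eps)
    .empL w' (hT _ hle ((hw.mono hle.1).trans (holds_addRel (.eq w' .eps))))
  right h T hST hT := hT T le_rfl fun _ hTU hw =>
    (monotone_inRight (hST.trans hTU) h).provable fun w' hw' => .empR w' (hw'.symm.trans hw)

theorem and (hA : Adequate V Ax A) (hB : Adequate V Ax B) : Adequate V Ax (.and A B) where
  left {w _} h := stable_forces _ w fun T hST hT =>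
    (monotone_inLeft hST h).provable fun w' hw =>
      have hle := le_addLeft (S := T.addLeft ⟨w', B⟩) ⟨w', A⟩
      .andL w' A B (hT _ ((le_addLeft _).trans hle)
        ⟨hA.left (inLeft_addLeft hw), (hB.left (inLeft_addLeft hw)).mono hle⟩)
  right h _ hST hT := (monotone_inRight hST h).provable fun w' hw =>
    .andR w' A B (hA.right (inRight_addRight hw) _ le_rfl (hT.1.mono (le_addRight _)))
      (hB.right (inRight_addRight hw) _ le_rfl (hT.2.mono (le_addRight _)))

theorem imp (hA : Adequate V Ax A) (hB : Adequate V Ax B) : Adequate V Ax (.imp A B) where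
  left {w _} h _ hST hAT := stable_forces B w fun _ hTU hU =>
    (monotone_inLeft (hST.trans hTU) h).provable fun w' hw =>
      .impL w' A B
        (hA.right (inRight_addRight hw) _ le_rfl (hAT.mono (hTU.trans (le_addRight _))))
        (hU _ (le_addLeft _) (hB.left (inLeft_addLeft hw)))
  right {w _} h T hST hT := (monotone_inRight hST h).provable fun w' hw =>
    have hAT : Forces Ax A w (T.addLeft ⟨w', A⟩) := hA.left (inLeft_addLeft hw)
    have hBT : Forces Ax B w (T.addLeft ⟨w', A⟩) := hT _ (le_addLeft _) hAT
    .impR w' A B (hB.right (inRight_addRight (S := T.addLeft ⟨w', A⟩) hw) _ le_rfl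
      (hBT.mono (le_addRight _)))

theorem star [Infinite V] (hA : Adequate V Ax A) (hB : Adequate V Ax B) :
    Adequate V Ax (.star A B) where
  left {z S} h T hST hT := (monotone_inLeft hST h).provable fun z' hz => by
    obtain ⟨σ, hσ, hfresh⟩ := (T.addLeft ⟨z', .star A B⟩).exists_fresh 2 Set.finite_empty
    have hT₁ := le_addRel (S := T) (.rel (.var (σ 0)) (.var (σ 1)) z')
    have hT₂ := le_addLeft (S := T.addRel (.rel (.var (σ 0)) (.var (σ 1)) z')) ⟨.var (σ 1), B⟩
    refine .starL z' A B (σ 0) (σ 1) (hσ.ne zero_ne_one) (hfresh 0).1 (hfresh 1).1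
      (hT _ (hT₁.trans (hT₂.trans (le_addLeft ⟨.var (σ 0), A⟩)))
        ⟨.var (σ 0), .var (σ 1), ?_, hA.left (inLeft_addLeft (.refl _)),
          (hB.left (inLeft_addLeft (.refl _))).mono (le_addLeft _)⟩)
    exact .rel_congr (.refl _) (.refl _) (hz.mono hT₁.1) (holds_addRel _)
  right {z S} h T hST hT := hT T le_rfl fun U hTU ⟨x, y, ⟨x', y', z', hr, hx, hy, hz⟩, hAU, hBU⟩ =>
    (monotone_inRight (hST.trans hTU) h).provable fun z'' hz' =>
      .starR x' y' z' z'' A B hr (hz.symm.trans hz')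
        (hA.right (inRight_addRight (S := U.addRight ⟨z'', .star A B⟩) hx) _ le_rfl
          (hAU.mono ((le_addRight _).trans (le_addRight _))))
        (hB.right (inRight_addRight (S := U.addRight ⟨z'', .star A B⟩) hy) _ le_rfl
          (hBU.mono ((le_addRight _).trans (le_addRight _))))

theorem wand [Infinite V] (hA : Adequate V Ax A) (hB : Adequate V Ax B) :
    Adequate V Ax (.wand A B) where
  left {z S} h x y T hST hT := stable_forces B y fun U hTU hU =>
    (monotone_inLeft (hST.trans hTU) h).provable fun z'' hz' => by
      obtain ⟨x', z', y', hr, hx, hz, hy⟩ := hT.1.mono hTU.1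
      exact .wandL x' z' z'' y' A B hr (hz.symm.trans hz')
        (hA.right (inRight_addRight (S := U.addLeft ⟨z'', .wand A B⟩) hx) _ le_rfl
          (hT.2.mono (hTU.trans ((le_addLeft _).trans (le_addRight _)))))
        (hU _ ((le_addLeft _).trans (le_addLeft _))
          (hB.left (inLeft_addLeft (S := U.addLeft ⟨z'', .wand A B⟩) hy)))
  right {z S} h T hST hT := (monotone_inRight hST h).provable fun z' hz => by
    obtain ⟨σ, hσ, hfresh⟩ := (T.addRight ⟨z', .wand A B⟩).exists_fresh 2 Set.finite_empty
    have hT₁ := le_addRel (S := T) (.rel (.var (σ 0)) z' (.var (σ 1)))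
    let T₂ := (T.addRel (.rel (.var (σ 0)) z' (.var (σ 1)))).addLeft ⟨.var (σ 0), A⟩
    have hrel : Holds T₂.rels (.rel (.var (σ 0)) z (.var (σ 1))) :=
      .rel_congr (.refl _) (hz.mono hT₁.1) (.refl _) (holds_addRel _)
    have hBT₂ : Forces Ax B (.var (σ 1)) T₂ :=
      hT _ _ T₂ (hT₁.trans (le_addLeft _)) ⟨hrel, hA.left (inLeft_addLeft (.refl _))⟩
    exact .wandR z' A B (σ 0) (σ 1) (hσ.ne zero_ne_one) (hfresh 0).1 (hfresh 1).1
      (hB.right (inRight_addRight (.refl _)) _ le_rfl (hBT₂.mono (le_addRight _)))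

end Adequate

theorem adequate (V : Type*) {P : Type*} [Infinite V] (Ax : Set FrameAxiom) (A : Formula P) :
    Adequate V Ax A := by
  induction A with
  | var p => exact .var p
  | top => exact .top
  | bot => exact .bot
  | emp => exact .emp
  | and A B ihA ihB => exact ihA.and ihB
  | imp A B ihA ihB => exact ihA.imp ihB
  | star A B ihA ihB => exact ihA.star ihB
  | wand A B ihA ihB => exact ihA.wand ihB

/-! ### Soundness -/

/-- With the labels interpreted by `ρ`, the world `S` satisfies `G`, forces `Γ` and refutes `Δ`. -/
structure Countermodel {V P : Type*} (Ax : Set FrameAxiom) (ρ : V → Label V)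
    (G : Finset (RelAtom (Label V))) (Γ Δ : Finset (LFormula V P)) (S : Sequent V P) : Prop where
  rels : ∀ r ∈ G, Holds S.rels (r.subst ρ)
  left : ∀ F ∈ Γ, Forces Ax F.formula (F.label.subst ρ) S
  right : ∀ F ∈ Δ, Refutes Ax F.formula (F.label.subst ρ) S

/-- Truth of the sequent `G; Γ ⊢ Δ` in the canonical model: its countermodels are absurd worlds. -/
def Valid {V P : Type*} (Ax : Set FrameAxiom) (G : Finset (RelAtom (Label V)))
    (Γ Δ : Finset (LFormula V P)) : Prop :=
  ∀ (ρ : V → Label V) (S : Sequent V P), Countermodel Ax ρ G Γ Δ S → S.Provable Ax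

section Soundness

variable {V P : Type*} {Ax : Set FrameAxiom} {ρ : V → Label V}
  {G G' : Finset (RelAtom (Label V))} {Γ Γ' Δ Δ' : Finset (LFormula V P)}
  {S T : Sequent V P} {w : Label V} {A B : Formula P}

namespace Countermodel

theorem mono (hS : Countermodel Ax ρ G Γ Δ S) (h : S ≤ T) : Countermodel Ax ρ G Γ Δ T :=
  ⟨fun r hr => (hS.rels r hr).mono h.1, fun F hF => (hS.left F hF).mono h,
    fun F hF => monotone_kripkeImp h (hS.right F hF)⟩

theorem anti (hS : Countermodel Ax ρ G Γ Δ S) (hG : G' ⊆ G) (hΓ : Γ' ⊆ Γ) (hΔ : Δ' ⊆ Δ) :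
    Countermodel Ax ρ G' Γ' Δ' S :=
  ⟨fun r hr => hS.rels r (hG hr), fun F hF => hS.left F (hΓ hF), fun F hF => hS.right F (hΔ hF)⟩

theorem insert_rel (hS : Countermodel Ax ρ G Γ Δ S) {r : RelAtom (Label V)}
    (hr : Holds S.rels (r.subst ρ)) : Countermodel Ax ρ (insert r G) Γ Δ S :=
  ⟨Finset.forall_mem_insert .. |>.2 ⟨hr, hS.rels⟩, hS.left, hS.right⟩

theorem insert_left (hS : Countermodel Ax ρ G Γ Δ S) (hA : Forces Ax A (w.subst ρ) S) :
    Countermodel Ax ρ G (insert ⟨w, A⟩ Γ) Δ S :=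
  ⟨hS.rels, Finset.forall_mem_insert .. |>.2 ⟨hA, hS.left⟩, hS.right⟩

theorem insert_right (hS : Countermodel Ax ρ G Γ Δ S) (hA : Refutes Ax A (w.subst ρ) S) :
    Countermodel Ax ρ G Γ (insert ⟨w, A⟩ Δ) S :=
  ⟨hS.rels, hS.left, Finset.forall_mem_insert .. |>.2 ⟨hA, hS.right⟩⟩

theorem forces (hS : Countermodel Ax ρ G (insert ⟨w, A⟩ Γ) Δ S) : Forces Ax A (w.subst ρ) S :=
  hS.left _ (Finset.mem_insert_self _ _)

theorem refutes (hS : Countermodel Ax ρ G Γ (insert ⟨w, A⟩ Δ) S) : Refutes Ax A (w.subst ρ) S :=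
  hS.right _ (Finset.mem_insert_self _ _)

theorem of_insert_left (hS : Countermodel Ax ρ G (insert ⟨w, A⟩ Γ) Δ S) :
    Countermodel Ax ρ G Γ Δ S :=
  hS.anti subset_rfl (Finset.subset_insert _ _) subset_rfl

theorem of_insert_right (hS : Countermodel Ax ρ G Γ (insert ⟨w, A⟩ Δ) S) :
    Countermodel Ax ρ G Γ Δ S :=
  hS.anti subset_rfl subset_rfl (Finset.subset_insert _ _)

theorem eqJudg (hS : Countermodel Ax ρ G Γ Δ S) {a b : Label V} (h : EqJudg G a b) :
    EqJudg S.rels (a.subst ρ) (b.subst ρ) :=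
  h.subst hS.rels

theorem extend (hS : Countermodel Ax ρ G Γ Δ S) {ι : Type*} {σ : ι → V}
    (hσ : ∀ j, Fresh (σ j) G Γ Δ) (τ : ι → Label V) :
    Countermodel Ax (Function.extend σ τ ρ) G Γ Δ S where
  rels r hr := by
    rw [RelAtom.subst_extend τ fun j => (hσ j).1 r hr]
    exact hS.rels r hr
  left F hF := by
    rw [Label.subst_extend τ fun j => (hσ j).2.1 F hF]
    exact hS.left F hF
  right F hF := by
    rw [Label.subst_extend τ fun j => (hσ j).2.2 F hF]
    exact hS.right F hF

theorem exists_extend_pair (hS : Countermodel Ax ρ G Γ Δ S) {x y : V} (hxy : x ≠ y)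
    (hx : Fresh x G Γ Δ) (hy : Fresh y G Γ Δ) (a b : Label V) :
    ∃ ρ', Countermodel Ax ρ' G Γ Δ S ∧ ρ' x = a ∧ ρ' y = b ∧
      ∀ l : Label V, x ∉ l.vars → y ∉ l.vars → l.subst ρ' = l.subst ρ := by
  have hinj : Function.Injective ![x, y] := by
    simpa [Function.Injective, Fin.forall_fin_two] using ⟨hxy, hxy.symm⟩
  exact ⟨Function.extend ![x, y] ![a, b] ρ, hS.extend (Fin.forall_fin_two.2 ⟨hx, hy⟩) _,
    hinj.extend_apply _ _ 0, hinj.extend_apply _ _ 1,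
    fun l hlx hly => Label.subst_extend _ (Fin.forall_fin_two.2 ⟨hlx, hly⟩)⟩

end Countermodel

namespace Valid

theorem forces (h : Valid Ax G Γ (insert ⟨w, A⟩ Δ)) (hS : Countermodel Ax ρ G Γ Δ S) :
    Forces Ax A (w.subst ρ) S :=
  stable_forces _ _ fun T hST hT => h ρ T ((hS.mono hST).insert_right hT)

theorem refutes (h : Valid Ax G (insert ⟨w, A⟩ Γ) Δ) (hS : Countermodel Ax ρ G Γ Δ S) :
    Refutes Ax A (w.subst ρ) S :=
  fun T hST hT => h ρ T ((hS.mono hST).insert_left hT)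

theorem starL {x y : V} {z : Label V} (hxy : x ≠ y)
    (hx : Fresh x G (insert ⟨z, .star A B⟩ Γ) Δ) (hy : Fresh y G (insert ⟨z, .star A B⟩ Γ) Δ)
    (h : Valid Ax (insert (.rel (.var x) (.var y) z) G)
      (insert ⟨.var x, A⟩ (insert ⟨.var y, B⟩ Γ)) Δ) :
    Valid Ax G (insert ⟨z, .star A B⟩ Γ) Δ := by
  refine fun ρ S hS => hS.forces S le_rfl fun T hST ⟨a, b, hr, hA, hB⟩ => ?_
  obtain ⟨ρ', hT, rfl, rfl, hρ'⟩ := (hS.mono hST).exists_extend_pair hxy hx hy a b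
  rw [← hρ' z (hx.2.1 _ (Finset.mem_insert_self _ _)) (hy.2.1 _ (Finset.mem_insert_self _ _))] at hr
  exact h ρ' T (((hT.of_insert_left.insert_left hB).insert_left hA).insert_rel hr)

theorem starR {x y z z' : Label V} (hr : RelAtom.rel x y z ∈ G) (hz : EqJudg G z z')
    (hA : Valid Ax G Γ (insert ⟨x, A⟩ (insert ⟨z', .star A B⟩ Δ)))
    (hB : Valid Ax G Γ (insert ⟨y, B⟩ (insert ⟨z', .star A B⟩ Δ))) :
    Valid Ax G Γ (insert ⟨z', .star A B⟩ Δ) :=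
  fun _ S hS => hS.refutes S le_rfl fun T hST hT => hT T le_rfl
    ⟨_, _, ((hS.mono hST).rels _ hr).rel_congr (.refl _) (.refl _) ((hS.mono hST).eqJudg hz).symm,
      hA.forces (hS.mono hST), hB.forces (hS.mono hST)⟩

theorem wandL {x y y' z : Label V} (hr : RelAtom.rel x y z ∈ G) (hy : EqJudg G y y')
    (hA : Valid Ax G (insert ⟨y', .wand A B⟩ Γ) (insert ⟨x, A⟩ Δ))
    (hB : Valid Ax G (insert ⟨z, B⟩ (insert ⟨y', .wand A B⟩ Γ)) Δ) :
    Valid Ax G (insert ⟨y', .wand A B⟩ Γ) Δ :=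
  fun _ S hS => hB.refutes hS S le_rfl <| hS.forces _ _ S le_rfl
    ⟨(hS.rels _ hr).rel_congr (.refl _) (hS.eqJudg hy).symm (.refl _), hA.forces hS⟩

theorem wandR {x y : V} {z : Label V} (hxy : x ≠ y)
    (hx : Fresh x G Γ (insert ⟨z, .wand A B⟩ Δ)) (hy : Fresh y G Γ (insert ⟨z, .wand A B⟩ Δ))
    (h : Valid Ax (insert (.rel (.var x) z (.var y)) G)
      (insert ⟨.var x, A⟩ Γ) (insert ⟨.var y, B⟩ Δ)) :
    Valid Ax G Γ (insert ⟨z, .wand A B⟩ Δ) := by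
  refine fun ρ S hS => hS.refutes S le_rfl fun a b T hST ⟨hr, hA⟩ => ?_
  obtain ⟨ρ', hT, rfl, rfl, hρ'⟩ := (hS.mono hST).exists_extend_pair hxy hx hy a b
  rw [← hρ' z (hx.2.2 _ (Finset.mem_insert_self _ _)) (hy.2.2 _ (Finset.mem_insert_self _ _))] at hr
  exact h.forces ((hT.of_insert_right.insert_left hA).insert_rel hr)

theorem nEq {x y : Label V} (hr : RelAtom.neq x y ∈ G) (h : EqJudg G x y) : Valid Ax G Γ Δ :=
  fun _ _ hS => provable_of_holds_neq_of_eqJudg (hS.rels _ hr) (hS.eqJudg h)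

theorem em {x y : Label V} (heq : Valid Ax (insert (.eq x y) G) Γ Δ)
    (hneq : Valid Ax (insert (.neq x y) G) Γ Δ) : Valid Ax G Γ Δ :=
  fun ρ S hS => closure_eqJudg_or_mem_neq (x.subst ρ) (y.subst ρ) S le_rfl fun T hST hT =>
    hT.elim (fun h => heq ρ T ((hS.mono hST).insert_rel h))
      fun h => hneq ρ T ((hS.mono hST).insert_rel (.of_mem h))

theorem frame [Infinite V] {F : FrameAxiom} (hF : F ∈ Ax) {θ : Fin F.m → Label V}
    {σ : Fin F.n → V} (hσ : Function.Injective σ) (hσ_fresh : ∀ j, Fresh (σ j) G Γ Δ)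
    (hσ_ne : ∀ j i, θ i ≠ Label.var (σ j))
    (heqs : ∀ e ∈ F.eqs, EqJudg G (e.1.subst θ) (e.2.subst θ))
    (hhyps : ∀ S ∈ F.hyps, S.subst θ ∈ G)
    (h : Valid Ax
      (G ∪ (F.concls.map (RelAtom.subst (Sum.elim θ fun j => Label.var (σ j)))).toFinset) Γ Δ) :
    Valid Ax G Γ Δ := by
  intro ρ S hS
  refine FrameAxiom.closure_exists_concls (θ := fun i => (θ i).subst ρ) hF (fun e he => ?_)
    (fun r hr => ?_) S le_rfl fun T hST ⟨τ, hτ⟩ => ?_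
  · simpa only [Label.subst_subst] using hS.eqJudg (heqs e he)
  · simpa only [RelAtom.subst_subst] using hS.rels _ (hhyps r hr)
  have hT := (hS.mono hST).extend hσ_fresh τ
  refine h (Function.extend σ τ ρ) T ⟨fun r hr => ?_, hT.left, hT.right⟩
  rcases Finset.mem_union.1 hr with hr | hr
  · exact hT.rels r hr
  obtain ⟨r₀, hr₀, rfl⟩ := List.mem_map.1 (List.mem_toFinset.1 hr)
  have hsubst : (fun k => (Sum.elim θ (fun j => Label.var (σ j)) k).subst
      (Function.extend σ τ ρ)) = Sum.elim (fun i => (θ i).subst ρ) τ := by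
    funext k
    rcases k with i | j
    · refine Label.subst_extend τ fun j hj => hσ_ne j i ?_
      cases hi : θ i <;> simp_all [Label.vars]
    · exact hσ.extend_apply τ ρ j
  rw [RelAtom.subst_subst, hsubst]
  exact hτ r₀ hr₀

theorem cut (h : Valid Ax G Γ (insert ⟨w, A⟩ Δ)) (h' : Valid Ax G' (insert ⟨w, A⟩ Γ') Δ') :
    Valid Ax (G ∪ G') (Γ ∪ Γ') (Δ ∪ Δ') := by
  intro ρ S hS
  have hS₁ : Countermodel Ax ρ G Γ Δ S :=
    hS.anti Finset.subset_union_left Finset.subset_union_left Finset.subset_union_left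
  have hS₂ : Countermodel Ax ρ G' Γ' Δ' S :=
    hS.anti Finset.subset_union_right Finset.subset_union_right Finset.subset_union_right
  exact h'.refutes hS₂ S le_rfl (h.forces hS₁)

/-- The world `G; Γ ⊢ Δ` is a countermodel of the sequent `G; Γ ⊢ Δ`. -/
theorem derivable [Infinite V] (h : Valid Ax G Γ Δ) : Derivable Ax false G Γ Δ := by
  refine h Label.var ⟨G, Γ, Δ⟩ ⟨fun r hr => ?_, fun F hF => ?_, fun F hF => ?_⟩
  · rw [RelAtom.subst_var]
    exact .of_mem hr
  · rw [Label.subst_var]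
    exact (adequate V Ax F.formula).left ⟨F.label, hF, .refl _⟩
  · rw [Label.subst_var]
    exact (adequate V Ax F.formula).right ⟨F.label, hF, .refl _⟩

end Valid

theorem Derivable.valid [Infinite V] {c : Bool} (d : Derivable Ax c G Γ Δ) : Valid Ax G Γ Δ := by
  induction d with
  | id w w' p h => exact fun ρ S hS => hS.refutes S le_rfl (hS.forces.var_congr (hS.eqJudg h))
  | botL w => exact fun ρ S hS => hS.forces S le_rfl trivial
  | topR w => exact fun ρ S hS => hS.refutes S le_rfl trivial
  | empL w _ ih =>
    exact fun ρ S hS => hS.forces S le_rfl fun T hST hw =>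
      ih ρ T ((hS.of_insert_left.mono hST).insert_rel hw)
  | empR w h =>
    exact fun ρ S hS => hS.refutes S le_rfl <|
      .of_monotone (fun _ _ hTU hw => hw.mono hTU.1) (hS.eqJudg h)
  | andL w A B _ ih =>
    exact fun ρ S hS =>
      ih ρ S ((hS.of_insert_left.insert_left hS.forces.2).insert_left hS.forces.1)
  | andR w A B _ _ ih₁ ih₂ =>
    exact fun ρ S hS => hS.refutes S le_rfl
      ⟨ih₁.forces hS.of_insert_right, ih₂.forces hS.of_insert_right⟩
  | impL w A B _ _ ih₁ ih₂ =>
    exact fun ρ S hS => ih₂.refutes hS.of_insert_left S le_rfl <|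
      hS.forces S le_rfl (ih₁.forces hS.of_insert_left)
  | impR w A B _ ih =>
    exact fun ρ S hS => hS.refutes S le_rfl fun T hST hA =>
      ih.forces ((hS.of_insert_right.mono hST).insert_left hA)
  | starL z A B x y hxy hx hy _ ih => exact ih.starL hxy hx hy
  | starR x y z z' A B hr h _ _ ih₁ ih₂ => exact ih₁.starR hr h ih₂
  | wandL x y y' z A B hr h _ _ ih₁ ih₂ => exact ih₁.wandL hr h ih₂
  | wandR z A B x y hxy hx hy _ ih => exact ih.wandR hxy hx hy
  | nEq x y hr h => exact .nEq hr h
  | em x y _ _ ih₁ ih₂ => exact ih₁.em ih₂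
  | frame F hF θ σ hσ hσ_fresh hσ_ne heqs hhyps _ ih =>
    exact ih.frame hF hσ hσ_fresh hσ_ne heqs hhyps
  | cut _ w A _ _ ih₁ ih₂ => exact ih₁.cut ih₂

end Soundness

end LSG

theorem mainTheorem6 {V P : Type*} [Infinite V] (Ax : Set LSG.FrameAxiom) :
    (∀ (G G' : Finset (LSG.RelAtom (LSG.Label V))) (Γ Γ' Δ Δ' : Finset (LSG.LFormula V P))
        (w : LSG.Label V) (A : LSG.Formula P),
      LSG.Derivable Ax false G Γ (insert ⟨w, A⟩ Δ) →
      LSG.Derivable Ax false G' (insert ⟨w, A⟩ Γ') Δ' →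
      LSG.Derivable Ax false (G ∪ G') (Γ ∪ Γ') (Δ ∪ Δ')) ∧
    (∀ (G : Finset (LSG.RelAtom (LSG.Label V))) (Γ Δ : Finset (LSG.LFormula V P)),
      LSG.Derivable Ax true G Γ Δ → LSG.Derivable Ax false G Γ Δ) :=
  ⟨fun _ _ _ _ _ _ _ _ d₁ d₂ => (d₁.valid.cut d₂.valid).derivable,
    fun _ _ _ d => d.valid.derivable⟩
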